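/- \textbf{Theorem (oracle inequalities for Lasso Poisson regression).} Let $n,p\ge 1$ and let $(X_1,Y_1),\dots,(X_n,Y_n)$ be i.i.d. copies of a pair $(X,Y)$, where $X$ is a random vector in $\mathbb{R}^p$ and, conditionally on $X$, $Y$ is Poisson distributed with mean $e^{X^T\beta_0}$ for some $\beta_0\in\mathbb{R}^p$. Let $$\beta^*\in\operatorname*{argmin}_{\beta\in\mathbb{R}^p}\mathrm{E}\big[-YX^T\beta+e^{X^T\beta}\big]$$ be the true coefficient, $S=\{j:\beta^*_j\neq 0\}$ and $s=|S|$. For $\lambda>0$ let $\hat\beta$ be a Lasso estimator, i.e. a (measurable) minimizer over $\beta\in\mathbb{R}^p$ of $$-\frac1n\sum_{i=1}^n\big[Y_iX_i^T\beta-e^{X_i^T\beta}\big]+\lambda\|\beta\|_1 .$$ Assume: (H.1) $\|X\|_\infty\le L$ almost surely, for some $L>0$; (H.2) $\|\beta^*\|_1\le B$ for some $B>0$; (H.3) (Stabil condition) with $\Sigma=\mathrm{E}(XX^T)$ there is $k\in(0,1)$ such that $\delta^T\Sigma\delta\ge k\sum_{j\in S}\delta_j^2$ for all $\delta\in\mathbb{R}^p$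 with $\sum_{j\notin S}|\delta_j|\le 3\sum_{j\in S}|\delta_j|$. Let $A>\sqrt2$ and $$\lambda\ge\max\Big\{\frac{16A^2L\log(2p)}{3n},\; 8ALe^{LB/2}\sqrt{\frac{\log(2p)}{n}},\; 20ALe^{LB}\sqrt{\frac{2\log(2p)}{n}}\Big\}.$$ Let $X^*$ be an independent copy of $X$ (independent of the sample), and let $\mathrm{E}^*$ be the expectation with respect to $X^*$ only. Then, with probability at least $1-(2p)^{1-A^2}-(2p)^{-A^2/2}$, both $$\|\hat\beta-\beta^*\|_1\le\frac{4e^{5LB}}{k}\,s\lambda\qquad\text{and}\qquad \mathrm{E}^*\big[X^{*T}(\hat\beta-\beta^*)\big]^2\le\frac{12e^{10LB}}{k}\,s\lambda^2 .$$ -/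

import Mathlib

open MeasureTheory ProbabilityTheory
open scoped Matrix NNReal

noncomputable section

namespace PoissonLasso

/-- The `ℓ₁`-norm on `ℝ^p`. -/
def l1Norm {p : ℕ} (b : Fin p → ℝ) : ℝ := ∑ j, |b j|

/-- The set `S(b)` of indices of the non-zero coordinates of `b`. -/
def supp {p : ℕ} (b : Fin p → ℝ) : Finset (Fin p) := {j | b j ≠ 0}

lemma measurable_poisson_exp {p : ℕ} (b : Fin p → ℝ) :
    Measurable fun x : Fin p → ℝ => poissonMeasure (Real.exp (x ⬝ᵥ b)).toNNReal := by
  refine Measure.measurable_of_measurable_coe _ fun s _ => ?_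
  simp only [poissonMeasure, Measure.sum_apply _ (MeasurableSet.of_discrete (s := s)),
    Measure.smul_apply, smul_eq_mul]
  refine Measurable.tsum fun n => ?_
  refine Measurable.mul_const ?_ _
  unfold dotProduct
  fun_prop

/-- The conditional law of the response in the Poisson regression model with coefficient `b`:
given the covariate vector `x`, the response is Poisson with mean `exp (xᵀ b)`. -/
def responseKernel {p : ℕ} (b : Fin p → ℝ) : Kernel (Fin p → ℝ) ℕ where
  toFun x := poissonMeasure (Real.exp (x ⬝ᵥ b)).toNNReal
  measurable' := measurable_poisson_exp b

instance {p : ℕ} (b : Fin p → ℝ) : IsMarkovKernel (responseKernel b) :=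
  ⟨fun x => inferInstanceAs
    (IsProbabilityMeasure (poissonMeasure (Real.exp (x ⬝ᵥ b)).toNNReal))⟩

/-- The joint law of a pair `(X, Y)` where `X` has law `ν` and `Y` given `X` is Poisson with mean
`exp (Xᵀ b)`. -/
def modelLaw {p : ℕ} (ν : Measure (Fin p → ℝ)) (b : Fin p → ℝ) : Measure ((Fin p → ℝ) × ℕ) :=
  ν ⊗ₘ responseKernel b

/-- The Poisson loss `l(y, x, b) = - y xᵀ b + exp (xᵀ b)`. -/
def poissonLoss {p : ℕ} (b : Fin p → ℝ) (z : (Fin p → ℝ) × ℕ) : ℝ :=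
  -((z.2 : ℝ) * (z.1 ⬝ᵥ b)) + Real.exp (z.1 ⬝ᵥ b)

/-- The expected Poisson loss under a joint law of covariates and response. -/
def expectedLoss {p : ℕ} (Q : Measure ((Fin p → ℝ) × ℕ)) (b : Fin p → ℝ) : ℝ :=
  ∫ z, poissonLoss b z ∂Q

/-- The average negative log-likelihood (without the terms free of `b`) for the data
`(x₁, y₁), …, (xₙ, yₙ)`. -/
def avgNegLogLik {n p : ℕ} (x : Fin n → Fin p → ℝ) (y : Fin n → ℕ) (b : Fin p → ℝ) : ℝ :=
  -(1 / (n : ℝ)) * ∑ i, ((y i : ℝ) * (x i ⬝ᵥ b) - Real.exp (x i ⬝ᵥ b))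

/-- `b` is a Lasso Poisson estimate with tuning parameter `lam` for the given data: a minimizer of
the `ℓ₁`-penalized average negative log-likelihood over the whole of `ℝ^p`. -/
def IsLassoEstimate {n p : ℕ} (lam : ℝ) (x : Fin n → Fin p → ℝ) (y : Fin n → ℕ)
    (b : Fin p → ℝ) : Prop :=
  IsMinOn (fun b' => avgNegLogLik x y b' + lam * l1Norm b') Set.univ b

/-- The second-moment matrix `Σ = E (X Xᵀ)` of a law on `ℝ^p`. -/
def secondMoment {p : ℕ} (ν : Measure (Fin p → ℝ)) : Matrix (Fin p) (Fin p) ℝ :=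
  Matrix.of fun i j => ∫ x, x i * x j ∂ν

/-- The cone `C(c₀, S)`. -/
def cone {p : ℕ} (c₀ : ℝ) (S : Finset (Fin p)) : Set (Fin p → ℝ) :=
  {δ | ∑ j ∈ Sᶜ, |δ j| ≤ c₀ * ∑ j ∈ S, |δ j|}

/-- The Stabil condition `S(c₀, S, k, Σ)`. -/
def StabilCondition {p : ℕ} (c₀ : ℝ) (S : Finset (Fin p)) (k : ℝ)
    (Sig : Matrix (Fin p) (Fin p) ℝ) : Prop :=
  ∀ δ ∈ cone c₀ S, k * ∑ j ∈ S, (δ j) ^ 2 ≤ δ ⬝ᵥ (Sig *ᵥ δ)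

end PoissonLasso

end

namespace PoissonLasso

/-! ### Elementary inequalities for the exponential -/

/-! Because `exp u - 1 - u` vanishes only at `u = 0`, any minimizer of the expected loss has a.s.
the same linear predictor as the model coefficient. So the sample also follows the model with
coefficient `βstar` (`modelLaw_congr`), and the score at `βstar` has conditional mean zero.

The rest is deterministic on the event where every coordinate of the normalized score is at most
`lam / 4` and every entry of the empirical second-moment matrix is close to its mean
(`oracle_inequalities`). Comparing the penalized objective at the estimate and at `βstar` puts the
error in the Stabil cone and bounds its `ℓ₁`-norm by `8 / 3 * B`. Linear predictors then stay in a
bounded range, where the exponential has curvature bounded below. The loss remainder thus dominates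
the empirical quadratic form, hence the population form up to an error that the penalty absorbs; the
Stabil condition closes the estimate (`error_bounds_of_basic_inequality`).

The event is likely by union bounds: Bernstein's inequality with the Poisson moment generating
function for the score, Hoeffding's inequality for the second moments. -/

lemma half_exp_neg_mul_sq_le {u m : ℝ} (h : |u| ≤ m) :
    Real.exp (-m) / 2 * u ^ 2 ≤ Real.exp u - 1 - u := by
  rcases le_total 0 u with hu | hu
  · have h1 := Real.quadratic_le_exp_of_nonneg hu
    have h2 : Real.exp (-m) ≤ 1 := Real.exp_le_one_iff.2 (by linarith [abs_nonneg u])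
    nlinarith [sq_nonneg u]
  -- This function vanishes at `0`; its value at `-u`, multiplied by `exp u`, is exactly `exp u - 1
  -- - u - exp u / 2 * u ^ 2`.
  · have hmono : Monotone fun v : ℝ => 1 + (v - 1) * Real.exp v - v ^ 2 / 2 := by
      have hd : ∀ v : ℝ, HasDerivAt (fun v : ℝ => 1 + (v - 1) * Real.exp v - v ^ 2 / 2)
          (v * (Real.exp v - 1)) v := by
        intro v
        have := ((((hasDerivAt_id v).sub_const 1).mul (Real.hasDerivAt_exp v)).const_add 1).sub
          ((hasDerivAt_pow 2 v).div_const 2)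
        refine this.congr_deriv ?_
        simp only [id]
        push_cast
        ring
      refine monotone_of_deriv_nonneg (fun v => (hd v).differentiableAt) fun v => ?_
      rw [(hd v).deriv]
      rcases le_total 0 v with hv | hv
      · exact mul_nonneg hv (by linarith [Real.add_one_le_exp v])
      · exact mul_nonneg_of_nonpos_of_nonpos hv (by linarith [Real.exp_le_one_iff.2 hv])
    have h1 := hmono (show (0 : ℝ) ≤ -u by linarith)
    simp only [zero_sub, Real.exp_zero] at h1
    have h2 : Real.exp (-m) ≤ Real.exp u :=
      Real.exp_le_exp.2 (by linarith [neg_abs_le u])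
    have h3 : Real.exp u * Real.exp (-u) = 1 := by rw [← Real.exp_add]; simp
    have h4 := mul_le_mul_of_nonneg_left h1 (Real.exp_pos u).le
    have h5 : Real.exp u * (1 + (-u - 1) * Real.exp (-u) - (-u) ^ 2 / 2)
      = Real.exp u - 1 - u - Real.exp u / 2 * u ^ 2 := by
      linear_combination (-u - 1) * h3
    rw [h5] at h4
    nlinarith [sq_nonneg u]

/-- Lets a geometric series of ratio `c / 3` dominate the exponential tail termwise; this is the
source of the `3` in Bernstein's inequality. -/
lemma two_mul_three_pow_le_factorial (k : ℕ) : 2 * 3 ^ k ≤ (k + 2).factorial := by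
  induction k with
  | zero => simp [Nat.factorial]
  | succ k ih =>
    rw [show k + 1 + 2 = (k + 2) + 1 by ring, Nat.factorial_succ, pow_succ]
    nlinarith

/-- The bound behind Bernstein's inequality. -/
lemma exp_sub_one_sub_le {z c : ℝ} (hz : |z| ≤ c) (hc : c < 3) :
    Real.exp z - 1 - z ≤ c ^ 2 / (2 * (1 - c / 3)) := by
  have hc0 : 0 ≤ c := (abs_nonneg z).trans hz
  have h1 : HasSum (fun k : ℕ => z ^ (k + 2) / (k + 2).factorial) (Real.exp z - 1 - z) := by
    have h := NormedSpace.expSeries_div_hasSum_exp z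
    rw [← Real.exp_eq_exp_ℝ] at h
    have := (hasSum_nat_add_iff' (f := fun k : ℕ => z ^ k / (k.factorial : ℝ)) 2).2 h
    simpa [Finset.sum_range_succ, sub_sub] using this
  have h2 : HasSum (fun k : ℕ => c ^ 2 / 2 * (c / 3) ^ k) (c ^ 2 / 2 * (1 - c / 3)⁻¹) :=
    (hasSum_geometric_of_lt_one (by positivity) (by linarith)).mul_left _
  have h3 : c ^ 2 / (2 * (1 - c / 3)) = c ^ 2 / 2 * (1 - c / 3)⁻¹ := by
    rw [div_mul_eq_div_div, div_eq_mul_inv _ (1 - c / 3)]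
  rw [h3]
  refine hasSum_le (fun k => ?_) h1 h2
  have hf : (2 * 3 ^ k : ℝ) ≤ (k + 2).factorial := by
    exact_mod_cast two_mul_three_pow_le_factorial k
  calc z ^ (k + 2) / (k + 2).factorial ≤ c ^ (k + 2) / (2 * 3 ^ k) := by
        refine div_le_div₀ (by positivity) ?_ (by positivity) hf
        calc z ^ (k + 2) ≤ |z ^ (k + 2)| := le_abs_self _
          _ = |z| ^ (k + 2) := abs_pow _ _
          _ ≤ c ^ (k + 2) := by gcongr
    _ = c ^ 2 / 2 * (c / 3) ^ k := by rw [div_pow, pow_add]; field_simp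

/-! ### Deterministic part of the oracle inequality -/

variable {n p : ℕ}

lemma abs_dotProduct_le_mul_l1Norm {x d : Fin p → ℝ} {L : ℝ} (hx : ∀ j, |x j| ≤ L) :
    |x ⬝ᵥ d| ≤ L * l1Norm d := by
  unfold dotProduct l1Norm
  rw [Finset.mul_sum]
  refine (Finset.abs_sum_le_sum_abs _ _).trans (Finset.sum_le_sum fun j _ => ?_)
  rw [abs_mul]
  exact mul_le_mul_of_nonneg_right (hx j) (abs_nonneg _)

/-- An exact first-order expansion: the remainder is a nonnegative Bregman term free of `y`, so all
the noise sits in the score paired with `d`. -/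
lemma avgNegLogLik_sub_eq (x : Fin n → Fin p → ℝ) (y : Fin n → ℕ) (b d : Fin p → ℝ) :
    avgNegLogLik x y (b + d) - avgNegLogLik x y b =
      (1 / (n : ℝ)) * (∑ i, Real.exp (x i ⬝ᵥ b) * (Real.exp (x i ⬝ᵥ d) - 1 - x i ⬝ᵥ d)) -
      (1 / (n : ℝ)) * ∑ j, (∑ i, ((y i : ℝ) - Real.exp (x i ⬝ᵥ b)) * x i j) * d j := by
  have h : ∑ j, (∑ i, ((y i : ℝ) - Real.exp (x i ⬝ᵥ b)) * x i j) * d j =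
      ∑ i, ((y i : ℝ) - Real.exp (x i ⬝ᵥ b)) * (x i ⬝ᵥ d) := by
    simp only [dotProduct, Finset.sum_mul, Finset.mul_sum]
    rw [Finset.sum_comm]
    simp only [mul_assoc]
  rw [h]
  simp only [avgNegLogLik, neg_mul, ← mul_neg, ← mul_sub, ← Finset.sum_sub_distrib,
    ← Finset.sum_neg_distrib]
  congr 1
  refine Finset.sum_congr rfl fun i _ => ?_
  rw [dotProduct_add, Real.exp_add]
  ring

lemma l1Norm_eq_sum_add_sum_compl (S : Finset (Fin p)) (d : Fin p → ℝ) :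
    l1Norm d = ∑ j ∈ S, |d j| + ∑ j ∈ Sᶜ, |d j| :=
  (Finset.sum_add_sum_compl S _).symm

/-- Decomposability of the `ℓ₁`-norm: off the support of `b` the vectors `b + d` and `d` agree, and
on it the triangle inequality applies. -/
lemma l1Norm_add_sum_compl_le (b d : Fin p → ℝ) :
    l1Norm b + ∑ j ∈ (supp b)ᶜ, |d j| ≤ l1Norm (b + d) + ∑ j ∈ supp b, |d j| := by
  rw [l1Norm_eq_sum_add_sum_compl (supp b) b, l1Norm_eq_sum_add_sum_compl (supp b) (b + d)]
  have h0 : ∀ j ∈ (supp b)ᶜ, b j = 0 := fun j hj => by simpa [supp] using hj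
  have h1 : ∑ j ∈ (supp b)ᶜ, |b j| = 0 := Finset.sum_eq_zero fun j hj => by simp [h0 j hj]
  have h2 : ∑ j ∈ (supp b)ᶜ, |(b + d) j| = ∑ j ∈ (supp b)ᶜ, |d j| :=
    Finset.sum_congr rfl fun j hj => by simp [h0 j hj]
  have h3 : ∑ j ∈ supp b, |b j| ≤ ∑ j ∈ supp b, |(b + d) j| + ∑ j ∈ supp b, |d j| := by
    rw [← Finset.sum_add_distrib]
    refine Finset.sum_le_sum fun j _ => ?_
    have := abs_sub (b j + d j) (d j)
    simpa using this
  linarith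

lemma l1Norm_le_l1Norm_add (b d : Fin p → ℝ) : l1Norm d ≤ l1Norm (b + d) + l1Norm b := by
  unfold l1Norm
  rw [← Finset.sum_add_distrib]
  refine Finset.sum_le_sum fun j _ => ?_
  have := abs_sub (b j + d j) (b j)
  simpa using this

/-- Comparison of the empirical and population quadratic forms. -/
lemma quadratic_form_sub_le (hn : 0 < n) {x : Fin n → Fin p → ℝ}
    {Sig : Matrix (Fin p) (Fin p) ℝ} {τ : ℝ}
    (hSig : ∀ j l, |∑ i, (x i j * x i l - Sig j l)| ≤ n * τ) (d : Fin p → ℝ) :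
    d ⬝ᵥ (Sig *ᵥ d) - τ * l1Norm d ^ 2 ≤ (1 / (n : ℝ)) * ∑ i, (x i ⬝ᵥ d) ^ 2 := by
  have hn' : (0 : ℝ) < n := by exact_mod_cast hn
  -- The discrepancy is a quadratic form in `d`, so an entrywise bound on its matrix costs only the
  -- squared `ℓ₁`-norm.
  have h1 : ∑ i, (x i ⬝ᵥ d) ^ 2 - n * (d ⬝ᵥ (Sig *ᵥ d)) =
      ∑ j, ∑ l, (d j * d l) * ∑ i, (x i j * x i l - Sig j l) := by
    have e1 : ∑ i, (x i ⬝ᵥ d) ^ 2 = ∑ j, ∑ l, ∑ i, (d j * d l) * (x i j * x i l) := by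
      simp only [dotProduct, sq, Finset.sum_mul_sum]
      rw [Finset.sum_comm]
      refine Finset.sum_congr rfl fun j _ => ?_
      rw [Finset.sum_comm]
      refine Finset.sum_congr rfl fun l _ => Finset.sum_congr rfl fun i _ => ?_
      ring
    have e2 : n * (d ⬝ᵥ (Sig *ᵥ d)) = ∑ j, ∑ l, ∑ _i : Fin n, (d j * d l) * Sig j l := by
      simp only [dotProduct, Matrix.mulVec, Finset.mul_sum, Finset.sum_const, Finset.card_univ,
        Fintype.card_fin, nsmul_eq_mul]
      refine Finset.sum_congr rfl fun j _ => Finset.sum_congr rfl fun l _ => ?_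
      ring
    rw [e1, e2]
    simp only [← Finset.sum_sub_distrib, ← mul_sub, Finset.mul_sum]
  have h2 : |∑ j, ∑ l, (d j * d l) * ∑ i, (x i j * x i l - Sig j l)| ≤
      n * τ * l1Norm d ^ 2 := by
    have : n * τ * l1Norm d ^ 2 = ∑ j, ∑ l, (|d j| * |d l|) * (n * τ) := by
      simp only [l1Norm, sq, Finset.sum_mul_sum, ← Finset.sum_mul]
      ring
    rw [this]
    refine (Finset.abs_sum_le_sum_abs _ _).trans (Finset.sum_le_sum fun j _ => ?_)
    refine (Finset.abs_sum_le_sum_abs _ _).trans (Finset.sum_le_sum fun l _ => ?_)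
    rw [abs_mul, abs_mul]
    exact mul_le_mul_of_nonneg_left (hSig j l) (by positivity)
  have h3 := (abs_le.1 h2).1
  rw [← h1] at h3
  rw [div_mul_eq_mul_div, one_mul, le_div_iff₀ hn']
  linarith

/-- Solving the basic inequality for the `ℓ₁`-error `a + c` and the prediction error `q`. -/
lemma error_bounds_of_basic_inequality {L B lam k s a c q : ℝ} (hL : 0 < L) (hB : 0 < B)
    (hlam : 0 < lam) (hk : 0 < k) (hs : 0 ≤ s) (ha : 0 ≤ a) (hc : 0 ≤ c)
    (hT : a + c ≤ 8 / 3 * B) (hq : k * a ^ 2 ≤ s * q) (hq0 : 0 ≤ q)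
    (hbasic : Real.exp (-(11 / 3 * (L * B))) / 2 *
      (q - L * lam * Real.exp (-(L * B)) / 16 * (a + c) ^ 2) + 3 / 4 * lam * c ≤
      5 / 4 * lam * a) :
    a + c ≤ 4 * Real.exp (5 * L * B) / k * (s * lam) ∧
      q ≤ 12 * Real.exp (10 * L * B) / k * (s * lam ^ 2) := by
  set m := L * B with hm
  have hm0 : 0 < m := by positivity
  set e := Real.exp (-(11 / 3 * m)) with he
  have he0 : 0 < e := Real.exp_pos _
  have he1 : e ≤ 1 := Real.exp_le_one_iff.2 (by linarith)
  have hmexp : m * Real.exp (-m) ≤ 1 := by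
    have h1 := Real.add_one_le_exp m
    have h2 : Real.exp m * Real.exp (-m) = 1 := by rw [← Real.exp_add]; simp
    nlinarith [Real.exp_pos (-m)]
  -- One factor `a + c` is replaced by `8 / 3 * B`; the resulting `m` is absorbed by `exp (-m)`,
  -- leaving a term linear in the error that the penalty can pay for.
  have herr : e / 2 * (L * lam * Real.exp (-m) / 16 * (a + c) ^ 2) ≤ lam * (a + c) / 12 := by
    have hT0 : 0 ≤ a + c := by positivity
    calc e / 2 * (L * lam * Real.exp (-m) / 16 * (a + c) ^ 2)
        = e * (L * lam * Real.exp (-m) * (a + c) / 32 * (a + c)) := by ring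
      _ ≤ 1 * (L * lam * Real.exp (-m) * (a + c) / 32 * (8 / 3 * B)) := by
          gcongr
      _ = (m * Real.exp (-m)) * (lam * (a + c) / 12) := by rw [hm]; ring
      _ ≤ 1 * (lam * (a + c) / 12) := by gcongr
      _ = lam * (a + c) / 12 := one_mul _
  have h1 : e / 2 * q + 2 / 3 * lam * (a + c) ≤ 2 * lam * a := by nlinarith
  have h2 : e / 2 * q ≤ 4 / 3 * lam * a := by nlinarith
  have hinv : e * Real.exp (11 / 3 * m) = 1 := by rw [he, ← Real.exp_add]; simp
  have hE1 : Real.exp (11 / 3 * m) ≤ Real.exp (5 * L * B) :=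
    Real.exp_le_exp.2 (by rw [hm] at *; linarith)
  have hE2 : Real.exp (11 / 3 * m) ^ 2 ≤ Real.exp (10 * L * B) := by
    rw [← Real.exp_nat_mul]
    exact Real.exp_le_exp.2 (by push_cast; rw [hm] at *; linarith)
  set E := Real.exp (11 / 3 * m)
  have hE0 : 0 < E := Real.exp_pos _
  constructor
  · have h3 : k * e * (a + c) ≤ 3 * (s * lam) := by
      -- The main case cancels `lam * s`, so empty support is separate: there `a = 0`, which forces
      -- `a + c ≤ 0`.
      rcases hs.eq_or_lt with hs0 | hs0
      · have ha0 : a = 0 := by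
          rw [← hs0, zero_mul] at hq
          have : a ^ 2 ≤ 0 := by
            by_contra! h
            nlinarith [mul_pos hk h]
          exact pow_eq_zero_iff (two_ne_zero) |>.1 (le_antisymm this (sq_nonneg a))
        have : lam * (a + c) ≤ 0 := by
          have : 0 ≤ e / 2 * q := by positivity
          rw [ha0] at h1 ⊢
          linarith
        have : a + c ≤ 0 := by
          by_contra! h
          nlinarith [mul_pos hlam h]
        rw [← hs0]
        have := mul_nonneg (mul_pos hk he0).le (neg_nonneg.2 this)
        linarith
      · have h4 : e / 2 * (k * a ^ 2) + 2 / 3 * lam * (a + c) * s ≤ 2 * lam * a * s := by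
          have := mul_le_mul_of_nonneg_left hq (by positivity : 0 ≤ e / 2)
          nlinarith
        -- Completing the square in `e * k * a` eliminates `a`.
        have h5 : (e * k) * (2 / 3 * lam * (a + c) * s) ≤ 2 * (lam * s) ^ 2 := by
          have := mul_le_mul_of_nonneg_left h4 (by positivity : 0 ≤ e * k)
          nlinarith [sq_nonneg (e * k * a - 2 * (lam * s))]
        have h6 : (lam * s) * (k * e * (a + c)) ≤ (lam * s) * (3 * (s * lam)) := by
          linarith
        exact le_of_mul_le_mul_left h6 (by positivity)
    calc a + c = E / k * (k * e * (a + c)) := by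
          field_simp
          linear_combination (-(a + c)) * hinv
      _ ≤ E / k * (3 * (s * lam)) := by gcongr
      _ ≤ Real.exp (5 * L * B) / k * (4 * (s * lam)) := by gcongr; norm_num
      _ = _ := by ring
  · have h3 : k * e ^ 2 * q ≤ 12 * (s * lam ^ 2) := by
      rcases hq0.eq_or_lt with hq0 | hq0
      · rw [← hq0, mul_zero]; positivity
      · have h4 : (e / 2 * q) ^ 2 ≤ (4 / 3 * lam * a) ^ 2 := by gcongr
        have h5 : k * (e / 2 * q) ^ 2 ≤ 16 / 9 * lam ^ 2 * (s * q) := by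
          calc k * (e / 2 * q) ^ 2 ≤ k * (4 / 3 * lam * a) ^ 2 := by gcongr
            _ = 16 / 9 * lam ^ 2 * (k * a ^ 2) := by ring
            _ ≤ _ := by gcongr
        have h6 : q * (k * e ^ 2 * q) ≤ q * (12 * (s * lam ^ 2)) := by
          nlinarith [mul_nonneg (mul_nonneg hs (sq_nonneg lam)) hq0.le]
        exact le_of_mul_le_mul_left h6 hq0
    calc q = E ^ 2 / k * (k * e ^ 2 * q) := by
          field_simp
          linear_combination (-q * (e * E + 1)) * hinv
      _ ≤ E ^ 2 / k * (12 * (s * lam ^ 2)) := by gcongr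
      _ ≤ Real.exp (10 * L * B) / k * (12 * (s * lam ^ 2)) := by gcongr
      _ = _ := by ring

/-- The oracle inequalities hold for every data set for which the score at `b` and the empirical
second-moment matrix are close to their means. -/
theorem oracle_inequalities (hn : 0 < n) {x : Fin n → Fin p → ℝ} {y : Fin n → ℕ}
    {b bhat : Fin p → ℝ} {Sig : Matrix (Fin p) (Fin p) ℝ} {L B k lam : ℝ} (hL : 0 < L)
    (hB : 0 < B) (hk : 0 < k) (hlam : 0 < lam) (hx : ∀ i j, |x i j| ≤ L) (hb : l1Norm b ≤ B)
    (hstabil : StabilCondition 3 (supp b) k Sig)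
    (hscore : ∀ j, |∑ i, ((y i : ℝ) - Real.exp (x i ⬝ᵥ b)) * x i j| ≤ n * lam / 4)
    (hSig : ∀ j l, |∑ i, (x i j * x i l - Sig j l)| ≤
      n * (L * lam * Real.exp (-(L * B)) / 16))
    (hmin : IsLassoEstimate lam x y bhat) :
    l1Norm (bhat - b) ≤ 4 * Real.exp (5 * L * B) / k * ((supp b).card * lam) ∧
      (bhat - b) ⬝ᵥ (Sig *ᵥ (bhat - b)) ≤
        12 * Real.exp (10 * L * B) / k * ((supp b).card * lam ^ 2) := by
  have hn' : (0 : ℝ) < n := by exact_mod_cast hn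
  obtain ⟨d, rfl⟩ : ∃ d, bhat = b + d := ⟨bhat - b, by simp⟩
  rw [add_sub_cancel_left]
  have hle := (isMinOn_iff.1 hmin) b (Set.mem_univ _)
  have hsub := avgNegLogLik_sub_eq x y b d
  set D := (1 / (n : ℝ)) *
    ∑ i, Real.exp (x i ⬝ᵥ b) * (Real.exp (x i ⬝ᵥ d) - 1 - x i ⬝ᵥ d) with hD
  have hlin : |(1 / (n : ℝ)) * ∑ j, (∑ i, ((y i : ℝ) - Real.exp (x i ⬝ᵥ b)) * x i j) * d j| ≤
      lam / 4 * l1Norm d := by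
    have h : |∑ j, (∑ i, ((y i : ℝ) - Real.exp (x i ⬝ᵥ b)) * x i j) * d j| ≤
      n * lam / 4 * l1Norm d := abs_dotProduct_le_mul_l1Norm hscore
    rw [abs_mul, abs_of_pos (by positivity), div_mul_eq_mul_div, one_mul, div_le_iff₀ hn']
    linarith
  have hD0 : 0 ≤ D := by
    refine mul_nonneg (by positivity) (Finset.sum_nonneg fun i _ => ?_)
    exact mul_nonneg (Real.exp_pos _).le (by linarith [Real.add_one_le_exp (x i ⬝ᵥ d)])
  have hbasic : D + lam * l1Norm (b + d) ≤ lam * l1Norm b + lam / 4 * l1Norm d := by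
    linarith [(abs_le.1 hlin).2]
  have hsplit := l1Norm_eq_sum_add_sum_compl (supp b) d
  have hdec := l1Norm_add_sum_compl_le b d
  have htri := l1Norm_le_l1Norm_add b d
  set a := ∑ j ∈ supp b, |d j| with ha
  set c := ∑ j ∈ (supp b)ᶜ, |d j| with hc
  have ha0 : 0 ≤ a := Finset.sum_nonneg fun _ _ => abs_nonneg _
  have hc0 : 0 ≤ c := Finset.sum_nonneg fun _ _ => abs_nonneg _
  have h1 : D + 3 / 4 * lam * c ≤ 5 / 4 * lam * a := by
    have := mul_le_mul_of_nonneg_left hdec hlam.le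
    rw [hsplit] at hbasic
    linarith
  -- The inequality gives the ratio `5 / 3`, inside the cone of constant `3`.
  have hca : c ≤ 3 * a := by
    have : lam * (3 * c) ≤ lam * (5 * a) := by linarith
    have := le_of_mul_le_mul_left this hlam
    linarith
  have hT : a + c ≤ 8 / 3 * B := by
    have : lam * l1Norm (b + d) ≤ lam * (l1Norm b + 1 / 4 * l1Norm d) := by linarith
    have := le_of_mul_le_mul_left this hlam
    linarith
  -- The exponent `11 / 3` is `1 + 8 / 3`: the weight `exp (x i ⬝ᵥ b)` is at least `exp (-(L * B))`,
  -- and the curvature bound holds on `|x i ⬝ᵥ d| ≤ 8 / 3 * (L * B)`.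
  have hDq : Real.exp (-(11 / 3 * (L * B))) / 2 *
      (d ⬝ᵥ (Sig *ᵥ d) - L * lam * Real.exp (-(L * B)) / 16 * (a + c) ^ 2) ≤ D := by
    have hq := quadratic_form_sub_le hn hSig d
    rw [hsplit] at hq
    refine (mul_le_mul_of_nonneg_left hq (by positivity)).trans ?_
    rw [hD, mul_left_comm]
    refine mul_le_mul_of_nonneg_left ?_ (by positivity)
    rw [Finset.mul_sum]
    refine Finset.sum_le_sum fun i _ => ?_
    have h2 : |x i ⬝ᵥ d| ≤ 8 / 3 * (L * B) := by
      refine (abs_dotProduct_le_mul_l1Norm (hx i)).trans ?_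
      rw [hsplit]
      nlinarith
    have h3 : -(L * B) ≤ x i ⬝ᵥ b := by
      refine le_trans ?_ (neg_abs_le _)
      have := abs_dotProduct_le_mul_l1Norm (d := b) (hx i)
      have := mul_le_mul_of_nonneg_left hb hL.le
      linarith
    have h4 : Real.exp (-(11 / 3 * (L * B))) =
        Real.exp (-(L * B)) * Real.exp (-(8 / 3 * (L * B))) := by
      rw [← Real.exp_add]; ring_nf
    calc Real.exp (-(11 / 3 * (L * B))) / 2 * (x i ⬝ᵥ d) ^ 2
        = Real.exp (-(L * B)) * (Real.exp (-(8 / 3 * (L * B))) / 2 * (x i ⬝ᵥ d) ^ 2) := by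
          rw [h4]; ring
      _ ≤ _ := mul_le_mul (Real.exp_le_exp.2 h3) (half_exp_neg_mul_sq_le h2) (by positivity)
          (Real.exp_pos _).le
  have hst := hstabil d hca
  have hq0 : 0 ≤ d ⬝ᵥ (Sig *ᵥ d) :=
    le_trans (mul_nonneg hk.le (Finset.sum_nonneg fun _ _ => sq_nonneg _)) hst
  have hcs : a ^ 2 ≤ (supp b).card * ∑ j ∈ supp b, (d j) ^ 2 := by
    have := sq_sum_le_card_mul_sum_sq (s := supp b) (f := fun j => |d j|)
    simpa only [sq_abs] using this
  have hq : k * a ^ 2 ≤ (supp b).card * (d ⬝ᵥ (Sig *ᵥ d)) := by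
    have h5 := mul_le_mul_of_nonneg_left hcs hk.le
    have h6 := mul_le_mul_of_nonneg_left hst (Nat.cast_nonneg (α := ℝ) (supp b).card)
    linarith
  rw [hsplit]
  exact error_bounds_of_basic_inequality hL hB hlam hk (Nat.cast_nonneg _) ha0 hc0 hT hq hq0
    (by linarith)

end PoissonLasso

namespace PoissonLasso

/-! ### Moments of the Poisson distribution -/

lemma hasSum_poisson_exp_mul (r : ℝ≥0) (t : ℝ) :
    HasSum (fun n : ℕ => Real.exp (-r) * r ^ n / n.factorial * Real.exp (t * n))
      (Real.exp (r * (Real.exp t - 1))) := by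
  have h := (NormedSpace.expSeries_div_hasSum_exp ((r : ℝ) * Real.exp t)).mul_left
    (Real.exp (-(r : ℝ)))
  rw [← Real.exp_eq_exp_ℝ, ← Real.exp_add] at h
  rw [show (r : ℝ) * (Real.exp t - 1) = -r + r * Real.exp t by ring]
  refine h.congr_fun fun n => ?_
  rw [mul_pow, ← Real.exp_nat_mul, mul_comm t]
  ring

lemma integrable_exp_mul_poissonMeasure (r : ℝ≥0) (t : ℝ) :
    Integrable (fun n : ℕ => Real.exp (t * n)) (poissonMeasure r) := by
  rw [integrable_poissonMeasure_iff]
  simpa only [Real.norm_eq_abs, Real.abs_exp] using (hasSum_poisson_exp_mul r t).summable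

lemma integral_exp_mul_poissonMeasure (r : ℝ≥0) (t : ℝ) :
    ∫ n : ℕ, Real.exp (t * n) ∂poissonMeasure r = Real.exp (r * (Real.exp t - 1)) := by
  rw [integral_poissonMeasure]
  exact (hasSum_poisson_exp_mul r t).tsum_eq

lemma integrable_natCast_poissonMeasure (r : ℝ≥0) :
    Integrable (fun n : ℕ => (n : ℝ)) (poissonMeasure r) := by
  refine (integrable_exp_mul_poissonMeasure r 1).mono' .of_discrete (ae_of_all _ fun n => ?_)
  rw [Real.norm_eq_abs, abs_of_nonneg n.cast_nonneg, one_mul]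
  linarith [Real.add_one_le_exp (n : ℝ)]

lemma integral_natCast_poissonMeasure (r : ℝ≥0) :
    ∫ n : ℕ, (n : ℝ) ∂poissonMeasure r = r := by
  have h := hasSum_integral_poissonMeasure (integrable_natCast_poissonMeasure r)
  -- The zeroth term vanishes, and the shifted series is `r` times the total-mass series.
  have h1 := (hasSum_nat_add_iff' 1).2 h
  have h2 := (hasSum_one_poissonMeasure r).mul_left (r : ℝ)
  have h3 := h1.unique (h2.congr_fun fun n => ?_)
  · simpa using h3
  · simp only [smul_eq_mul, Nat.factorial_succ]
    push_cast
    field_simp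
    ring

/-! ### The Poisson regression model -/

variable {p : ℕ} {ν : Measure (Fin p → ℝ)} {L B : ℝ}
  {b : Fin p → ℝ}

@[fun_prop]
lemma measurable_dotProduct_const (b : Fin p → ℝ) :
    Measurable fun x : Fin p → ℝ => x ⬝ᵥ b := by
  unfold dotProduct
  fun_prop

instance [IsProbabilityMeasure ν] (b : Fin p → ℝ) : IsProbabilityMeasure (modelLaw ν b) :=
  inferInstanceAs (IsProbabilityMeasure (ν ⊗ₘ responseKernel b))

lemma responseKernel_apply (b x : Fin p → ℝ) :
    responseKernel b x = poissonMeasure (Real.exp (x ⬝ᵥ b)).toNNReal := rfl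

lemma integral_natCast_responseKernel (b x : Fin p → ℝ) :
    ∫ y : ℕ, (y : ℝ) ∂responseKernel b x = Real.exp (x ⬝ᵥ b) := by
  rw [responseKernel_apply, integral_natCast_poissonMeasure,
    Real.coe_toNNReal _ (Real.exp_pos _).le]

lemma map_fst_modelLaw [IsProbabilityMeasure ν] (b : Fin p → ℝ) : (modelLaw ν b).map Prod.fst = ν :=
  Measure.fst_compProd ν (responseKernel b)

/-- A function whose conditional absolute moments are bounded is integrable for the model. -/
lemma integrable_modelLaw [IsProbabilityMeasure ν] {f : (Fin p → ℝ) × ℕ → ℝ} (hf : Measurable f) {C : ℝ}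
    (hint : ∀ x, Integrable (fun y => f (x, y)) (responseKernel b x))
    (hC : ∀ᵐ x ∂ν, ∫ y, ‖f (x, y)‖ ∂responseKernel b x ≤ C) :
    Integrable f (modelLaw ν b) := by
  refine (Measure.integrable_compProd_iff hf.aestronglyMeasurable).2 ⟨ae_of_all _ hint, ?_⟩
  refine Integrable.of_bound (C := C) ?_ ?_
  · exact (hf.norm.stronglyMeasurable.integral_kernel_prod_right' (κ := responseKernel b)).aestronglyMeasurable
  · filter_upwards [hC] with x hx
    rwa [Real.norm_eq_abs, abs_of_nonneg (integral_nonneg fun _ => norm_nonneg _)]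

lemma expectedLoss_modelLaw [IsProbabilityMeasure ν] (hX : ∀ᵐ x ∂ν, ∀ j, |x j| ≤ L) (b b' : Fin p → ℝ) :
    expectedLoss (modelLaw ν b) b' =
      ∫ x, (-(Real.exp (x ⬝ᵥ b) * (x ⬝ᵥ b')) + Real.exp (x ⬝ᵥ b')) ∂ν := by
  have hi : ∀ x : Fin p → ℝ, Integrable (fun y : ℕ => (y : ℝ) * (x ⬝ᵥ b'))
      (responseKernel b x) := fun x => (integrable_natCast_poissonMeasure _).mul_const _
  have hint : Integrable (poissonLoss b') (modelLaw ν b) := by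
    refine integrable_modelLaw (C := Real.exp (L * l1Norm b) * (L * l1Norm b') +
      Real.exp (L * l1Norm b')) ?_ (fun x => (hi x).neg.add (integrable_const (Real.exp (x ⬝ᵥ b')))) ?_
    · unfold poissonLoss
      have : Measurable fun z : (Fin p → ℝ) × ℕ => (z.2 : ℝ) :=
        (Measurable.of_discrete (f := fun n : ℕ => (n : ℝ))).comp measurable_snd
      fun_prop
    · filter_upwards [hX] with x hx
      have h1 := abs_dotProduct_le_mul_l1Norm (d := b) hx
      have h2 := abs_dotProduct_le_mul_l1Norm (d := b') hx
      have hle : ∀ y : ℕ, ‖poissonLoss b' (x, y)‖ ≤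
          (y : ℝ) * |x ⬝ᵥ b'| + Real.exp (x ⬝ᵥ b') := by
        intro y
        refine (norm_add_le _ _).trans (le_of_eq ?_)
        simp
      have hi' : Integrable (fun y : ℕ => (y : ℝ) * |x ⬝ᵥ b'|) (responseKernel b x) :=
        (integrable_natCast_poissonMeasure _).mul_const _
      calc ∫ y, ‖poissonLoss b' (x, y)‖ ∂responseKernel b x
          ≤ ∫ y : ℕ, ((y : ℝ) * |x ⬝ᵥ b'| + Real.exp (x ⬝ᵥ b')) ∂responseKernel b x :=
            integral_mono_of_nonneg (ae_of_all _ fun _ => norm_nonneg _)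
              (hi'.add (integrable_const _)) (ae_of_all _ hle)
        _ = Real.exp (x ⬝ᵥ b) * |x ⬝ᵥ b'| + Real.exp (x ⬝ᵥ b') := by
            rw [integral_add hi' (integrable_const _), integral_mul_const,
              integral_natCast_responseKernel]
            simp
        _ ≤ _ := by
            gcongr
            · exact (le_abs_self _).trans h1
            · exact (le_abs_self _).trans h2
  rw [expectedLoss, modelLaw, Measure.integral_compProd hint]
  refine integral_congr_ae (ae_of_all _ fun x => ?_)
  simp only [poissonLoss]
  rw [integral_add (f := fun y : ℕ => -((y : ℝ) * (x ⬝ᵥ b'))) (hi x).neg (integrable_const _),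
    integral_neg, integral_mul_const,    integral_natCast_responseKernel]
  simp

/-- A minimizer of the expected loss induces the same linear predictor as the coefficient of
the model. -/
lemma ae_dotProduct_eq_of_isMinOn [IsProbabilityMeasure ν] (hX : ∀ᵐ x ∂ν, ∀ j, |x j| ≤ L) {b b' : Fin p → ℝ}
    (hmin : IsMinOn (expectedLoss (modelLaw ν b)) Set.univ b') :
    ∀ᵐ x ∂ν, x ⬝ᵥ b' = x ⬝ᵥ b := by
  have hint : ∀ c : Fin p → ℝ, Integrable
      (fun x => -(Real.exp (x ⬝ᵥ b) * (x ⬝ᵥ c)) + Real.exp (x ⬝ᵥ c)) ν := by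
    intro c
    refine Integrable.of_bound (C := Real.exp (L * l1Norm b) * (L * l1Norm c) +
      Real.exp (L * l1Norm c)) (by fun_prop) ?_
    filter_upwards [hX] with x hx
    have h1 := abs_dotProduct_le_mul_l1Norm (d := b) hx
    have h2 := abs_dotProduct_le_mul_l1Norm (d := c) hx
    refine (norm_add_le _ _).trans ?_
    rw [norm_neg, norm_mul, Real.norm_eq_abs, Real.norm_eq_abs, Real.norm_eq_abs, Real.abs_exp,
      Real.abs_exp]
    gcongr
    · exact (le_abs_self _).trans h1
    · exact (le_abs_self _).trans h2
  have hle := isMinOn_iff.1 hmin b (Set.mem_univ _)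
  rw [expectedLoss_modelLaw hX, expectedLoss_modelLaw hX] at hle
  -- The excess loss is a positive weight times `exp u - 1 - u`, with `u` the difference of
  -- predictors; a nonpositive integral therefore forces `u = 0` a.e.
  have heq : ∀ x : Fin p → ℝ,
      (-(Real.exp (x ⬝ᵥ b) * (x ⬝ᵥ b')) + Real.exp (x ⬝ᵥ b')) -
        (-(Real.exp (x ⬝ᵥ b) * (x ⬝ᵥ b)) + Real.exp (x ⬝ᵥ b)) =
      Real.exp (x ⬝ᵥ b) *
        (Real.exp (x ⬝ᵥ b' - x ⬝ᵥ b) - 1 - (x ⬝ᵥ b' - x ⬝ᵥ b)) := by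
    intro x
    rw [mul_sub, mul_sub, ← Real.exp_add]
    ring_nf
  have hnonneg : ∀ x : Fin p → ℝ, 0 ≤ (-(Real.exp (x ⬝ᵥ b) * (x ⬝ᵥ b')) + Real.exp (x ⬝ᵥ b')) -
        (-(Real.exp (x ⬝ᵥ b) * (x ⬝ᵥ b)) + Real.exp (x ⬝ᵥ b)) := by
    intro x
    rw [heq]
    exact mul_nonneg (Real.exp_pos _).le
      (by linarith [Real.add_one_le_exp (x ⬝ᵥ b' - x ⬝ᵥ b)])
  have hzero := (integral_eq_zero_iff_of_nonneg hnonneg ((hint b').sub (hint b))).1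
    (le_antisymm (by rw [integral_sub (hint b') (hint b)]; linarith)
      (integral_nonneg hnonneg))
  filter_upwards [hzero] with x hx
  by_contra hne
  have h1 := Real.add_one_lt_exp (sub_ne_zero.2 hne)
  have h2 : 0 < Real.exp (x ⬝ᵥ b) *
        (Real.exp (x ⬝ᵥ b' - x ⬝ᵥ b) - 1 - (x ⬝ᵥ b' - x ⬝ᵥ b)) :=
    mul_pos (Real.exp_pos _) (by linarith)
  rw [← heq] at h2
  exact h2.ne' hx

/-- The coefficient enters only through the linear predictor, so no identifiability is needed. -/
lemma modelLaw_congr {b b' : Fin p → ℝ} (h : ∀ᵐ x ∂ν, x ⬝ᵥ b' = x ⬝ᵥ b) :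
    modelLaw ν b = modelLaw ν b' := by
  refine Measure.compProd_congr ?_
  filter_upwards [h] with x hx
  rw [responseKernel_apply, responseKernel_apply, hx]

/-- A weighted residual of the Poisson regression model. -/
noncomputable def weightedResidual (b : Fin p → ℝ) (h : (Fin p → ℝ) → ℝ) (z : (Fin p → ℝ) × ℕ) : ℝ :=
  ((z.2 : ℝ) - Real.exp (z.1 ⬝ᵥ b)) * h z.1

lemma measurable_weightedResidual (b : Fin p → ℝ) {h : (Fin p → ℝ) → ℝ} (hh : Measurable h) :
    Measurable (weightedResidual b h) := by
  unfold weightedResidual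
  have : Measurable fun z : (Fin p → ℝ) × ℕ => (z.2 : ℝ) :=
    (Measurable.of_discrete (f := fun n : ℕ => (n : ℝ))).comp measurable_snd
  fun_prop

lemma exp_mul_weightedResidual (b : Fin p → ℝ) (h : (Fin p → ℝ) → ℝ) (t : ℝ) (x : Fin p → ℝ)
    (y : ℕ) : Real.exp (t * weightedResidual b h (x, y)) =
      Real.exp (t * h x * y) * Real.exp (-(t * h x * Real.exp (x ⬝ᵥ b))) := by
  rw [← Real.exp_add, weightedResidual]
  ring_nf

lemma integrable_exp_mul_weightedResidual_responseKernel (b : Fin p → ℝ) (h : (Fin p → ℝ) → ℝ)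
    (t : ℝ) (x : Fin p → ℝ) :
    Integrable (fun y => Real.exp (t * weightedResidual b h (x, y))) (responseKernel b x) := by
  simp only [exp_mul_weightedResidual]
  exact (integrable_exp_mul_poissonMeasure _ _).mul_const _

lemma integral_exp_mul_weightedResidual_responseKernel (b : Fin p → ℝ) (h : (Fin p → ℝ) → ℝ)
    (t : ℝ) (x : Fin p → ℝ) :
    ∫ y, Real.exp (t * weightedResidual b h (x, y)) ∂responseKernel b x =
      Real.exp (Real.exp (x ⬝ᵥ b) * (Real.exp (t * h x) - 1 - t * h x)) := by
  simp only [exp_mul_weightedResidual]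
  rw [integral_mul_const, responseKernel_apply, integral_exp_mul_poissonMeasure,
    Real.coe_toNNReal _ (Real.exp_pos _).le, ← Real.exp_add]
  ring_nf

/-- The Poisson conditional log-mgf is its mean times `exp (t * h x) - 1 - t * h x`, so the
unbounded response still obeys a Bernstein-type bound. -/
lemma integral_exp_mul_weightedResidual_responseKernel_le (hX : ∀ᵐ x ∂ν, ∀ j, |x j| ≤ L)
    (hL : 0 ≤ L) (hb : l1Norm b ≤ B) {h : (Fin p → ℝ) → ℝ} (hhL : ∀ᵐ x ∂ν, |h x| ≤ L) {t : ℝ}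
    (ht : 0 ≤ t) (htL : t * L < 3) :
    ∀ᵐ x ∂ν, ∫ y, Real.exp (t * weightedResidual b h (x, y)) ∂responseKernel b x ≤
      Real.exp (Real.exp (L * B) * ((t * L) ^ 2 / (2 * (1 - t * L / 3)))) := by
  filter_upwards [hX, hhL] with x hx hhx
  rw [integral_exp_mul_weightedResidual_responseKernel]
  have h1 : |t * h x| ≤ t * L := by
    rw [abs_mul, abs_of_nonneg ht]
    exact mul_le_mul_of_nonneg_left hhx ht
  have h2 : x ⬝ᵥ b ≤ L * B := (le_abs_self _).trans
    ((abs_dotProduct_le_mul_l1Norm hx).trans (mul_le_mul_of_nonneg_left hb hL))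
  refine Real.exp_le_exp.2 (mul_le_mul (Real.exp_le_exp.2 h2) (exp_sub_one_sub_le h1 htL) ?_
    (Real.exp_pos _).le)
  linarith [Real.add_one_le_exp (t * h x)]

lemma integrable_exp_mul_weightedResidual [IsProbabilityMeasure ν] (hX : ∀ᵐ x ∂ν, ∀ j, |x j| ≤ L)
    (hL : 0 ≤ L) (hb : l1Norm b ≤ B) {h : (Fin p → ℝ) → ℝ} (hh : Measurable h)
    (hhL : ∀ᵐ x ∂ν, |h x| ≤ L) {t : ℝ} (ht : 0 ≤ t) (htL : t * L < 3) :
    Integrable (fun z => Real.exp (t * weightedResidual b h z)) (modelLaw ν b) := by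
  refine integrable_modelLaw ((measurable_weightedResidual b hh).const_mul t).exp
    (C := Real.exp (Real.exp (L * B) * ((t * L) ^ 2 / (2 * (1 - t * L / 3)))))
    (integrable_exp_mul_weightedResidual_responseKernel b h t) ?_
  simp only [Real.norm_eq_abs, Real.abs_exp]
  exact integral_exp_mul_weightedResidual_responseKernel_le hX hL hb hhL ht htL

lemma mgf_weightedResidual_le [IsProbabilityMeasure ν] (hX : ∀ᵐ x ∂ν, ∀ j, |x j| ≤ L)
    (hL : 0 ≤ L) (hb : l1Norm b ≤ B) {h : (Fin p → ℝ) → ℝ} (hh : Measurable h)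
    (hhL : ∀ᵐ x ∂ν, |h x| ≤ L) {t : ℝ} (ht : 0 ≤ t) (htL : t * L < 3) :
    mgf (weightedResidual b h) (modelLaw ν b) t ≤
      Real.exp (Real.exp (L * B) * ((t * L) ^ 2 / (2 * (1 - t * L / 3)))) := by
  have hle := integral_exp_mul_weightedResidual_responseKernel_le hX hL hb hhL ht htL
  rw [mgf, modelLaw, Measure.integral_compProd
    (integrable_exp_mul_weightedResidual hX hL hb hh hhL ht htL)]
  refine (integral_mono_of_nonneg (ae_of_all _ fun x => integral_nonneg fun _ =>
    (Real.exp_pos _).le) (integrable_const _) hle).trans (le_of_eq ?_)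
  simp

/-! ### Concentration inequalities -/

/-- **Bernstein's inequality** for independent random variables with bounded moment generating
functions. -/
theorem measure_sum_ge_le_of_mgf_le {Ω : Type*} [MeasurableSpace Ω] {μ : Measure Ω}
    [IsProbabilityMeasure μ] {n : ℕ} {W : Fin n → Ω → ℝ} (hindep : iIndepFun W μ)
    (hW : ∀ i, AEMeasurable (W i) μ) {v : ℝ} (hn : 0 < n) (hv : 0 < v) (hL : 0 < L)
    (hint : ∀ i t, 0 ≤ t → t * L < 3 → Integrable (fun ω => Real.exp (t * W i ω)) μ)
    (hmgf : ∀ i t, 0 ≤ t → t * L < 3 →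
      mgf (W i) μ t ≤ Real.exp (v * (t ^ 2 / (2 * (1 - t * L / 3)))))
    {u : ℝ} (hu : 0 ≤ u) :
    μ.real {ω | u ≤ ∑ i, W i ω} ≤ Real.exp (-(u ^ 2 / (2 * (n * v + L * u / 3)))) := by
  have hn' : (0 : ℝ) < n := by exact_mod_cast hn
  set w := n * v + L * u / 3 with hw
  have hw0 : 0 < w := by positivity
  -- This Chernoff parameter makes `1 - t * L / 3` equal to `n * v / w`, so the exponent collapses.
  set t := u / w with ht
  have ht0 : 0 ≤ t := by positivity
  have htL : t * L < 3 := by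
    rw [ht, div_mul_eq_mul_div, div_lt_iff₀ hw0, hw]
    nlinarith [mul_pos hn' hv]
  have hmgf_sum := hindep.mgf_sum₀ (t := t) hW Finset.univ
  have hpos : 0 < mgf (∑ i, W i) μ t := by
    rw [hmgf_sum]
    exact Finset.prod_pos fun i _ => mgf_pos (hint i t ht0 htL)
  -- A non-integrable function has Bochner integral `0`, so positivity of the mgf yields
  -- integrability.
  have hint_sum : Integrable (fun ω => Real.exp (t * (∑ i, W i) ω)) μ :=
    not_imp_comm.1 integral_undef hpos.ne'
  have hle : mgf (∑ i, W i) μ t ≤ Real.exp (n * (v * (t ^ 2 / (2 * (1 - t * L / 3))))) := by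
    rw [hmgf_sum, Real.exp_nat_mul]
    refine (Finset.prod_le_prod (fun i _ => mgf_nonneg) fun i _ => hmgf i t ht0 htL).trans ?_
    simp
  have hchern := measure_ge_le_exp_mul_mgf u ht0 hint_sum
  simp only [Finset.sum_apply] at hchern
  refine hchern.trans ((mul_le_mul_of_nonneg_left hle (Real.exp_pos _).le).trans (le_of_eq ?_))
  rw [← Real.exp_add]
  congr 1
  have h1 : 1 - t * L / 3 = n * v / w := by
    rw [ht]
    field_simp
    rw [hw]
    ring
  rw [h1, ht]
  field_simp
  ring

variable {Ω : Type*} [MeasurableSpace Ω] {μ : Measure Ω} {n : ℕ}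
  {X : Fin n → Ω → Fin p → ℝ} {Y : Fin n → Ω → ℕ}

lemma measure_sum_weightedResidual_ge_le [IsProbabilityMeasure ν] [IsProbabilityMeasure μ]
    (hn : 0 < n)
    (hlaw : ∀ i, HasLaw (fun ω => (X i ω, Y i ω)) (modelLaw ν b) μ)
    (hindep : iIndepFun (fun i ω => (X i ω, Y i ω)) μ)
    (hX : ∀ᵐ x ∂ν, ∀ j, |x j| ≤ L) (hL : 0 < L) (hb : l1Norm b ≤ B)
    {h : (Fin p → ℝ) → ℝ} (hh : Measurable h) (hhL : ∀ᵐ x ∂ν, |h x| ≤ L) {u : ℝ} (hu : 0 ≤ u) :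
    μ.real {ω | u ≤ ∑ i, ((Y i ω : ℝ) - Real.exp (X i ω ⬝ᵥ b)) * h (X i ω)} ≤
      Real.exp (-(u ^ 2 / (2 * (n * (Real.exp (L * B) * L ^ 2) + L * u / 3)))) := by
  have hm := measurable_weightedResidual b hh
  refine measure_sum_ge_le_of_mgf_le
    (W := fun i ω => weightedResidual b h (X i ω, Y i ω))
    (hindep.comp (fun _ => weightedResidual b h) fun _ => hm)
    (fun i => hm.comp_aemeasurable (hlaw i).aemeasurable) hn (by positivity) hL
    (fun i t ht htL => ?_) (fun i t ht htL => ?_) hu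
  · have := integrable_exp_mul_weightedResidual hX hL.le hb hh hhL ht htL
    rw [← (hlaw i).map_eq] at this
    exact this.comp_aemeasurable (hlaw i).aemeasurable
  · have h1 := mgf_weightedResidual_le hX hL.le hb hh hhL ht htL
    rw [← (hlaw i).map_eq, mgf_map (hlaw i).aemeasurable
      ((hm.const_mul t).exp.aestronglyMeasurable)] at h1
    refine h1.trans (le_of_eq ?_)
    congr 1
    ring

/-- **Hoeffding's inequality** for a bounded function of the covariates. -/
lemma measure_sum_sub_integral_ge_le [IsProbabilityMeasure ν]
    (hlaw : ∀ i, HasLaw (X i) ν μ) (hindep : iIndepFun X μ)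
    {g : (Fin p → ℝ) → ℝ} (hg : Measurable g) {C : ℝ} (hC : 0 ≤ C)
    (hgC : ∀ᵐ x ∂ν, |g x| ≤ C) {u : ℝ} (hu : 0 ≤ u) :
    μ.real {ω | u ≤ ∑ i, (g (X i ω) - ∫ x, g x ∂ν)} ≤
      Real.exp (-(u ^ 2 / (2 * (n * C ^ 2)))) := by
  have hsub : HasSubgaussianMGF (fun x => g x - ∫ x, g x ∂ν) ((‖C - -C‖₊ / 2) ^ 2) ν :=
    hasSubgaussianMGF_of_mem_Icc hg.aemeasurable (by
      filter_upwards [hgC] with x hx using abs_le.1 hx)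
  have hsub' : ∀ i ∈ Finset.univ, HasSubgaussianMGF
      (fun ω => g (X i ω) - ∫ x, g x ∂ν) ((‖C - -C‖₊ / 2) ^ 2) μ := fun i _ => by
    refine HasSubgaussianMGF.of_map (Y := X i) (X := fun x => g x - ∫ x, g x ∂ν)
      (hlaw i).aemeasurable ?_
    rwa [(hlaw i).map_eq]
  have hind := hindep.comp (fun _ x => g x - ∫ x, g x ∂ν) fun _ => hg.sub_const _
  refine (HasSubgaussianMGF.measure_sum_ge_le_of_iIndepFun hind hsub' hu).trans (le_of_eq ?_)
  have : (‖C - -C‖ / 2) ^ 2 = C ^ 2 := by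
    rw [Real.norm_eq_abs, abs_of_nonneg (by linarith)]
    ring
  simp [neg_div] at this ⊢
  rw [this]

end PoissonLasso

/-! ### High-probability control of the score and the second moments -/

namespace PoissonLasso

variable {p : ℕ} {ν : Measure (Fin p → ℝ)} {L B : ℝ} {b : Fin p → ℝ}

lemma integral_dotProduct_sq [IsProbabilityMeasure ν] (hX : ∀ᵐ x ∂ν, ∀ j, |x j| ≤ L)
    (d : Fin p → ℝ) :
    ∫ x, (x ⬝ᵥ d) ^ 2 ∂ν = d ⬝ᵥ (secondMoment ν *ᵥ d) := by
  have hint : ∀ j l, Integrable (fun x : Fin p → ℝ => (d j * d l) * (x j * x l)) ν := by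
    intro j l
    refine (Integrable.of_bound (C := L * L) (by fun_prop) ?_).const_mul _
    filter_upwards [hX] with x hx
    rw [norm_mul]
    exact mul_le_mul (hx j) (hx l) (abs_nonneg _) ((abs_nonneg _).trans (hx j))
  have h1 : ∀ x : Fin p → ℝ, (x ⬝ᵥ d) ^ 2 = ∑ j, ∑ l, (d j * d l) * (x j * x l) := by
    intro x
    simp only [dotProduct, sq, Finset.sum_mul_sum]
    refine Finset.sum_congr rfl fun j _ => Finset.sum_congr rfl fun l _ => ?_
    ring
  simp only [h1]
  rw [integral_finsetSum _ fun j _ => integrable_finsetSum _ fun l _ => hint j l]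
  simp only [dotProduct, Matrix.mulVec, Finset.mul_sum]
  refine Finset.sum_congr rfl fun j _ => ?_
  rw [integral_finsetSum _ fun l _ => hint j l]
  refine Finset.sum_congr rfl fun l _ => ?_
  rw [integral_const_mul, secondMoment, Matrix.of_apply]
  ring

variable {Ω : Type*} [MeasurableSpace Ω] {μ : Measure Ω} [IsProbabilityMeasure μ] {n : ℕ}

/-- A union bound for finitely many sums exceeding a level in absolute value. -/
lemma measure_exists_lt_abs_le {ι : Type*} [Fintype ι] {Z : ι → Ω → ℝ} {u c : ℝ}
    (hpos : ∀ i, μ.real {ω | u ≤ Z i ω} ≤ c) (hneg : ∀ i, μ.real {ω | u ≤ -Z i ω} ≤ c) :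
    μ.real {ω | ∃ i, u < |Z i ω|} ≤ Fintype.card ι * (2 * c) := by
  have hsub : {ω | ∃ i, u < |Z i ω|} ⊆ ⋃ i, ({ω | u ≤ Z i ω} ∪ {ω | u ≤ -Z i ω}) := by
    rintro ω ⟨i, hi⟩
    refine Set.mem_iUnion.2 ⟨i, ?_⟩
    rcases lt_abs.1 hi with h | h
    · exact Or.inl h.le
    · exact Or.inr h.le
  refine (measureReal_mono hsub).trans ((measureReal_iUnion_fintype_le _).trans ?_)
  refine (Finset.sum_le_sum (g := fun _ => 2 * c) fun i _ => ?_).trans (by simp)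
  refine (measureReal_union_le _ _).trans ?_
  linarith [hpos i, hneg i]

variable {X : Fin n → Ω → Fin p → ℝ} {Y : Fin n → Ω → ℕ} {A lam : ℝ}

/-- The score at the true coefficient is uniformly small with high probability. -/
lemma measure_exists_lt_abs_score_le [IsProbabilityMeasure ν] (hn : 0 < n) (hp : 0 < p)
    (hlaw : ∀ i, HasLaw (fun ω => (X i ω, Y i ω)) (modelLaw ν b) μ)
    (hindep : iIndepFun (fun i ω => (X i ω, Y i ω)) μ)
    (hX : ∀ᵐ x ∂ν, ∀ j, |x j| ≤ L) (hL : 0 < L) (hb : l1Norm b ≤ B) (hA : 0 ≤ A)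
    (hlam : 0 < lam)
    (hlam₁ : 16 * A ^ 2 * L * Real.log (2 * p) / (3 * n) ≤ lam)
    (hlam₂ : 8 * A * L * Real.exp (L * B / 2) * √(Real.log (2 * p) / n) ≤ lam) :
    μ.real {ω | ∃ j, n * lam / 4 < |∑ i, ((Y i ω : ℝ) - Real.exp (X i ω ⬝ᵥ b)) * X i ω j|} ≤
      (2 * (p : ℝ)) ^ (1 - A ^ 2) := by
  have hn' : (0 : ℝ) < n := by exact_mod_cast hn
  have hp1 : (1 : ℝ) ≤ p := by exact_mod_cast hp
  have hp' : (0 : ℝ) < 2 * p := by linarith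
  have hlog : 0 ≤ Real.log (2 * p) := Real.log_nonneg (by linarith)
  set l := Real.log (2 * p) with hl
  have hexp : Real.exp (-((n * lam / 4) ^ 2 /
      (2 * (n * (Real.exp (L * B) * L ^ 2) + L * (n * lam / 4) / 3)))) ≤
      (2 * (p : ℝ)) ^ (-A ^ 2) := by
    rw [Real.rpow_def_of_pos hp', ← hl]
    refine Real.exp_le_exp.2 ?_
    rw [mul_neg, neg_le_neg_iff, le_div_iff₀ (by positivity)]
    -- The Bernstein denominator has a linear and a variance part; `h1` and `h2` each bound one of
    -- them by half of `(n * lam / 4) ^ 2`.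
    have h1 : 16 * A ^ 2 * L * l ≤ lam * (3 * n) := (div_le_iff₀ (by positivity)).1 hlam₁
    have h2 : 64 * A ^ 2 * L ^ 2 * Real.exp (L * B) * l ≤ lam ^ 2 * n := by
      have h3 := pow_le_pow_left₀ (by positivity) hlam₂ 2
      rw [mul_pow, Real.sq_sqrt (by positivity), mul_pow, mul_pow, mul_pow, ← Real.exp_nat_mul,
        ← mul_div_assoc, div_le_iff₀ hn'] at h3
      rw [show ((2 : ℕ) : ℝ) * (L * B / 2) = L * B by push_cast; ring] at h3
      linarith
    have h4 := mul_le_mul_of_nonneg_left h1 (by positivity : 0 ≤ (n : ℝ) * lam)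
    have h5 := mul_le_mul_of_nonneg_left h2 hn'.le
    linarith
  have hmain : ∀ h : (Fin p → ℝ) → ℝ, Measurable h → (∀ᵐ x ∂ν, |h x| ≤ L) →
      μ.real {ω | n * lam / 4 ≤ ∑ i, ((Y i ω : ℝ) - Real.exp (X i ω ⬝ᵥ b)) * h (X i ω)} ≤
        (2 * (p : ℝ)) ^ (-A ^ 2) := fun h hh hhL =>
    (measure_sum_weightedResidual_ge_le hn hlaw hindep hX hL hb hh hhL (by positivity)).trans hexp
  refine (measure_exists_lt_abs_le (c := (2 * (p : ℝ)) ^ (-A ^ 2)) (fun j => ?_)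
    fun j => ?_).trans (le_of_eq ?_)
  · exact hmain (fun x => x j) (by fun_prop) (by filter_upwards [hX] with x hx using hx j)
  · have := hmain (fun x => -x j) (by fun_prop)
      (by filter_upwards [hX] with x hx using by rw [abs_neg]; exact hx j)
    simpa only [mul_neg, Finset.sum_neg_distrib] using this
  · rw [Fintype.card_fin, sub_eq_add_neg, Real.rpow_add hp', Real.rpow_one]
    ring

/-- The empirical second-moment matrix is uniformly close to its mean with high probability. -/
lemma measure_exists_lt_abs_secondMoment_le [IsProbabilityMeasure ν] (hn : 0 < n) (hp : 0 < p)
    (hlaw : ∀ i, HasLaw (X i) ν μ) (hindep : iIndepFun X μ)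
    (hX : ∀ᵐ x ∂ν, ∀ j, |x j| ≤ L) (hL : 0 < L) (hA : √2 < A) (hlam : 0 < lam)
    (hlam₃ : 20 * A * L * Real.exp (L * B) * √(2 * Real.log (2 * p) / n) ≤ lam) :
    μ.real {ω | ∃ jl : Fin p × Fin p, n * (L * lam * Real.exp (-(L * B)) / 16) <
        |∑ i, (X i ω jl.1 * X i ω jl.2 - secondMoment ν jl.1 jl.2)|} ≤
      (2 * (p : ℝ)) ^ (-A ^ 2 / 2) := by
  have hn' : (0 : ℝ) < n := by exact_mod_cast hn
  have hp1 : (1 : ℝ) ≤ p := by exact_mod_cast hp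
  have hp' : (0 : ℝ) < 2 * p := by linarith
  have hlog : 0 ≤ Real.log (2 * p) := Real.log_nonneg (by linarith)
  have hA0 : 0 < A := (Real.sqrt_nonneg 2).trans_lt hA
  have hA2 : 2 ≤ A ^ 2 := by
    have := pow_le_pow_left₀ (Real.sqrt_nonneg 2) hA.le 2
    rwa [Real.sq_sqrt (by norm_num)] at this
  set l := Real.log (2 * p) with hl
  -- The extra `-2` pays for the union over `p ^ 2` entries and two signs. It is available since
  -- `lam` yields the rate `25 / 16 * A ^ 2`, and `A ^ 2 / 2 + 2 ≤ 3 / 2 * A ^ 2` by `hA2`.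
  have hexp : Real.exp (-((n * (L * lam * Real.exp (-(L * B)) / 16)) ^ 2 /
      (2 * (n * (L * L) ^ 2)))) ≤ (2 * (p : ℝ)) ^ (-A ^ 2 / 2 - 2) := by
    rw [Real.rpow_def_of_pos hp', ← hl]
    refine Real.exp_le_exp.2 ?_
    rw [neg_le, ← mul_neg, le_div_iff₀ (by positivity)]
    have hinv : Real.exp (-(L * B)) * Real.exp (L * B) = 1 := by rw [← Real.exp_add]; simp
    have h1 : 20 * A * L * √(2 * l / n) ≤ lam * Real.exp (-(L * B)) := by
      calc 20 * A * L * √(2 * l / n)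
          = (20 * A * L * Real.exp (L * B) * √(2 * l / n)) * Real.exp (-(L * B)) := by
            linear_combination (-(20 * A * L * √(2 * l / n))) * hinv
        _ ≤ _ := by gcongr
    have h2 : 800 * A ^ 2 * L ^ 2 * l ≤ (lam * Real.exp (-(L * B))) ^ 2 * n := by
      have h3 := pow_le_pow_left₀ (by positivity) h1 2
      rw [mul_pow, Real.sq_sqrt (by positivity), ← mul_div_assoc, div_le_iff₀ hn'] at h3
      linarith
    have h4 := mul_le_mul_of_nonneg_left h2 (by positivity : 0 ≤ (n : ℝ) * L ^ 2)
    have h5 := mul_le_mul_of_nonneg_left hA2 (by positivity : 0 ≤ (n : ℝ) * L ^ 4 * l)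
    nlinarith
  have hmain : ∀ g : (Fin p → ℝ) → ℝ, Measurable g → (∀ᵐ x ∂ν, |g x| ≤ L * L) →
      μ.real {ω | n * (L * lam * Real.exp (-(L * B)) / 16) ≤
        ∑ i, (g (X i ω) - ∫ x, g x ∂ν)} ≤ (2 * (p : ℝ)) ^ (-A ^ 2 / 2 - 2) := fun g hg hgL =>
    (measure_sum_sub_integral_ge_le hlaw hindep hg (by positivity) hgL (by positivity)).trans hexp
  have hbound : ∀ j l, ∀ᵐ x ∂ν, |x j * x l| ≤ L * L := by
    intro j l
    filter_upwards [hX] with x hx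
    rw [abs_mul]
    exact mul_le_mul (hx j) (hx l) (abs_nonneg _) hL.le
  refine (measure_exists_lt_abs_le (c := (2 * (p : ℝ)) ^ (-A ^ 2 / 2 - 2)) (fun jl => ?_)
    fun jl => ?_).trans ?_
  · exact hmain (fun x => x jl.1 * x jl.2) (by fun_prop) (hbound _ _)
  · have := hmain (fun x => -(x jl.1 * x jl.2)) (by fun_prop)
      (by simpa only [abs_neg] using hbound _ _)
    simp only [integral_neg] at this
    have hsum : ∀ ω, -∑ i, (X i ω jl.1 * X i ω jl.2 - secondMoment ν jl.1 jl.2) =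
        ∑ i, (-(X i ω jl.1 * X i ω jl.2) - -∫ x, x jl.1 * x jl.2 ∂ν) := by
      intro ω
      rw [← Finset.sum_neg_distrib]
      refine Finset.sum_congr rfl fun i _ => ?_
      rw [neg_sub, sub_neg_eq_add, neg_add_eq_sub, secondMoment, Matrix.of_apply]
    simpa only [hsum] using this
  · rw [Fintype.card_prod, Fintype.card_fin, Real.rpow_sub hp', Real.rpow_two]
    have := Real.rpow_pos_of_pos hp' (-A ^ 2 / 2)
    rw [mul_div_assoc', mul_div_assoc', div_le_iff₀ (by positivity)]
    push_cast
    nlinarith [mul_pos this (by positivity : (0 : ℝ) < p * p)]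

end PoissonLasso

/-! ### The probabilistic oracle inequalities -/

theorem mainTheorem4 {n p : ℕ} (hn : 0 < n) (hp : 0 < p)
    {Ω : Type*} [MeasurableSpace Ω] (μ : Measure Ω) [IsProbabilityMeasure μ]
    -- the law of the covariate vector
    (ν : Measure (Fin p → ℝ)) [IsProbabilityMeasure ν]
    -- the coefficient of the model, and a minimizer of the expected Poisson loss
    (β₀ βstar : Fin p → ℝ)
    (hβstar : IsMinOn (PoissonLasso.expectedLoss (PoissonLasso.modelLaw ν β₀)) Set.univ βstar)
    -- the i.i.d. sample
    (X : Fin n → Ω → (Fin p → ℝ)) (Y : Fin n → Ω → ℕ)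
    (hlaw : ∀ i, HasLaw (fun ω => (X i ω, Y i ω)) (PoissonLasso.modelLaw ν β₀) μ)
    (hindep : iIndepFun (fun i ω => (X i ω, Y i ω)) μ)
    (L B k A lam : ℝ)
    (hL : 0 < L) (hX : ∀ᵐ x ∂ν, ∀ j, |x j| ≤ L)
    (hB : 0 < B) (hβB : PoissonLasso.l1Norm βstar ≤ B)
    (hk : k ∈ Set.Ioo (0 : ℝ) 1)
    (hstabil : PoissonLasso.StabilCondition 3 (PoissonLasso.supp βstar) k
      (PoissonLasso.secondMoment ν))
    (hA : √2 < A)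
    (hlam₁ : 16 * A ^ 2 * L * Real.log (2 * p) / (3 * n) ≤ lam)
    (hlam₂ : 8 * A * L * Real.exp (L * B / 2) * √(Real.log (2 * p) / n) ≤ lam)
    (hlam₃ : 20 * A * L * Real.exp (L * B) * √(2 * Real.log (2 * p) / n) ≤ lam)
    -- the Lasso estimator
    (βhat : Ω → (Fin p → ℝ)) (hmeas : AEMeasurable βhat μ)
    (hβhat : ∀ᵐ ω ∂μ, PoissonLasso.IsLassoEstimate lam (fun i => X i ω) (fun i => Y i ω) (βhat ω)) :
    1 - (2 * (p : ℝ)) ^ (1 - A ^ 2) - (2 * (p : ℝ)) ^ (-A ^ 2 / 2) ≤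
      μ.real {ω |
        PoissonLasso.l1Norm (βhat ω - βstar) ≤
          4 * Real.exp (5 * L * B) / k * ((PoissonLasso.supp βstar).card * lam) ∧
        ∫ x, (x ⬝ᵥ (βhat ω - βstar)) ^ 2 ∂ν ≤
          12 * Real.exp (10 * L * B) / k * ((PoissonLasso.supp βstar).card * lam ^ 2)} := by
  have hn' : (0 : ℝ) < n := by exact_mod_cast hn
  have hp1 : (1 : ℝ) ≤ p := by exact_mod_cast hp
  have hA0 : 0 < A := (Real.sqrt_nonneg 2).trans_lt hA
  have hlog : 0 < Real.log (2 * p) := Real.log_pos (by linarith)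
  have hlam : 0 < lam := lt_of_lt_of_le (by positivity) hlam₁
  rw [PoissonLasso.modelLaw_congr (PoissonLasso.ae_dotProduct_eq_of_isMinOn hX hβstar)] at hlaw
  have hlawX : ∀ i, HasLaw (X i) ν μ := fun i =>
    HasLaw.fun_comp (Y := Prod.fst)
      ⟨measurable_fst.aemeasurable, PoissonLasso.map_fst_modelLaw βstar⟩ (hlaw i)
  have hindepX : iIndepFun X μ := hindep.comp (fun _ => Prod.fst) fun _ => measurable_fst
  have hscore := PoissonLasso.measure_exists_lt_abs_score_le hn hp hlaw hindep hX hL hβB hA0.le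
    hlam hlam₁ hlam₂
  have hmoment := PoissonLasso.measure_exists_lt_abs_secondMoment_le hn hp hlawX hindepX hX hL hA
    hlam hlam₃
  set S₁ := {ω | ∃ j, n * lam / 4 <
    |∑ i, ((Y i ω : ℝ) - Real.exp (X i ω ⬝ᵥ βstar)) * X i ω j|} with hS₁
  set S₂ := {ω | ∃ jl : Fin p × Fin p, n * (L * lam * Real.exp (-(L * B)) / 16) <
    |∑ i, (X i ω jl.1 * X i ω jl.2 - PoissonLasso.secondMoment ν jl.1 jl.2)|} with hS₂
  set G := {ω | PoissonLasso.l1Norm (βhat ω - βstar) ≤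
      4 * Real.exp (5 * L * B) / k * ((PoissonLasso.supp βstar).card * lam) ∧
    ∫ x, (x ⬝ᵥ (βhat ω - βstar)) ^ 2 ∂ν ≤
      12 * Real.exp (10 * L * B) / k * ((PoissonLasso.supp βstar).card * lam ^ 2)} with hG
  have hXae : ∀ᵐ ω ∂μ, ∀ i j, |X i ω j| ≤ L :=
    ae_all_iff.2 fun i => ae_of_ae_map (hlawX i).aemeasurable (by rwa [(hlawX i).map_eq])
  -- Covering the space and using subadditivity avoids complements, hence any measurability of `G`.
  have hcover : (G ∪ (S₁ ∪ S₂) : Set Ω) =ᵐ[μ] Set.univ := by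
    refine Filter.eventuallyEq_univ.2 ?_
    filter_upwards [hXae, hβhat] with ω hω hmin
    by_cases h₁ : ω ∈ S₁
    · exact Or.inr (Or.inl h₁)
    by_cases h₂ : ω ∈ S₂
    · exact Or.inr (Or.inr h₂)
    refine Or.inl ?_
    simp only [hS₁, hS₂, Set.mem_ofPred_eq, not_exists, not_lt] at h₁ h₂
    rw [hG, Set.mem_ofPred_eq, PoissonLasso.integral_dotProduct_sq hX]
    exact PoissonLasso.oracle_inequalities hn hL hB hk.1 hlam hω hβB hstabil h₁
      (fun j l => h₂ (j, l)) hmin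
  have hone : 1 ≤ μ.real G + (μ.real S₁ + μ.real S₂) := by
    rw [← probReal_univ (μ := μ), ← measureReal_congr hcover]
    exact (measureReal_union_le _ _).trans
      (add_le_add_right (measureReal_union_le _ _) _)
  linarith
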